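/- Let $\sigma(a)=\max\{0,a\}$. There are absolute constants $C_1,C_2>0$ such that the following holds for all real $\varepsilon\ge 0$ with $\varepsilon\neq 3$, all $\eta>0$ and all integers $K_1,K_2\ge 0$ with \[ K_1\ \ge\ C_1\,\frac{\log(\eta^{-1})}{\log\left(\frac54+\frac{\varepsilon}{2}\right)},\qquad K_2\ \ge\ C_2\,\frac{\log(\eta^{-1})}{1+\varepsilon}. \] Put $n=K_1+K_2$, let $\mathbf u\in\mathbb R^{2n}$ be given by $u_i=1$ for $1\le i\le n$ and $u_i=-1$ for $n+1\le i\le 2n$, and let $\mathbf v\in\mathbb R^{2n}$ be random with independent entries $v_i\sim\mathrm{Unif}[-1,1]$. Then, with probability at least $1-\delta$ over $\mathbf v$, where \[ \delta=\exp\left(-\frac{K_2(1+\varepsilon)^2}{8(3-\varepsilon)^2}\right)+\exp\left(-\frac{K_1}{18}\right)+\exp\left(-\max\{\varepsilon,\eta\}K_1\right), \] for every $w\in[-\frac12,\frac12]$ there exist $\mathbf s\in\{0,1\}^{2n}$ and $\mathbf y\in[-\varepsilon,\varepsilon]^{2n}$ such that \[ \sup_{x\in\mathbb R,\ |x|\le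 1}\left|wx-(\mathbf v+\mathbf y)^\top\sigma\big((\mathbf u\odot\mathbf s)x\big)\right|<\eta . \] Here $\odot$ is the entrywise product and $\sigma$ is applied entrywise; $\mathbf s,\mathbf y$ may depend on $\mathbf v$ and $w$. -/

import Mathlib

open MeasureTheory ProbabilityTheory

noncomputable section

/-- The ReLU activation `σ(a) = max {0, a}`. -/
def relu (a : ℝ) : ℝ := max 0 a

/-- The two-layer network `x ↦ vᵀ σ(u x)` with `m` hidden neurons, one input and one output;
the activation acts entrywise. -/
def twoLayerNet {m : ℕ} (v u : Fin m → ℝ) (x : ℝ) : ℝ :=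
  ∑ i, v i * relu (u i * x)

/-- The deterministic first layer `u ∈ ℝ^{2n}`: the first `n` entries are `1`, the others `-1`. -/
def signLayer (n : ℕ) : Fin (2 * n) → ℝ :=
  fun i => if (i : ℕ) < n then 1 else -1

/-- The law of a vector of `m` independent entries, each uniform on `[-1, 1]`. -/
def unifLaw (m : ℕ) : Measure (Fin m → ℝ) :=
  Measure.pi fun _ => (volume : Measure ℝ)[|Set.Icc (-1 : ℝ) 1]

/-- `s ∈ {0, 1}^m`. -/
def IsMask {m : ℕ} (s : Fin m → ℝ) : Prop :=
  ∀ i, s i = 0 ∨ s i = 1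

/-- `y ∈ [-ε, ε]^m`. -/
def IsPerturbation {m : ℕ} (ε : ℝ) (y : Fin m → ℝ) : Prop :=
  ∀ i, y i ∈ Set.Icc (-ε) ε

/-- The worst-case error `sup_{|x| ≤ 1} |w x - (v + y)ᵀ σ((u ⊙ s) x)|`. The function of `x` is
continuous on a compact interval, so the supremum is a genuine (finite, attained) one. -/
def approxError {m : ℕ} (w : ℝ) (v y u s : Fin m → ℝ) : ℝ :=
  ⨆ x : Set.Icc (-1 : ℝ) 1, |w * (x : ℝ) - twoLayerNet (v + y) (u * s) (x : ℝ)|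

/-- The failure probability `δ`. -/
def failureBound (ε η : ℝ) (K₁ K₂ : ℕ) : ℝ :=
  Real.exp (-((K₂ : ℝ) * (1 + ε) ^ 2 / (8 * (3 - ε) ^ 2)))
    + Real.exp (-((K₁ : ℝ) / 18))
    + Real.exp (-(max ε η * (K₁ : ℝ)))

end

/-! The network with mask `s` equals `a * relu x + b * relu (-x)`, where `a` and `b` are perturbed
subset sums over the two halves of `v`. It therefore suffices that each half approximates every
weight of the window to within `η` (`Covers`); a union bound handles the two halves.

If `η > 1/2`, the empty mask works; if `ε ≥ 3/2`, one neuron can be perturbed to any target exactly.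
Otherwise no perturbation is used, and the claim is a random subset-sum estimate. Let `A` be the set
reachable so far, of measure `a`. A fresh uniform entry adds measure `a * (1 - a) / 2` on average,
and the odds `(1 - a) / a` shrink in mean by the factor `3/4` (`integral_missOdds_extend_le`).
Starting from an interval of length `η`, Markov's inequality makes the odds less than `η / 2`
outside probability `2 * (3/4)^n / η^2`. The reachable set then misses too little of the window to
leave a gap of length `η / 2`.

Of the three terms of `δ`, only `exp (-K₁ / 18)` is needed. -/

/-- The uniform law on `[-1, 1]`. -/
noncomputable def unifOne : Measure ℝ := (volume : Measure ℝ)[|Set.Icc (-1 : ℝ) 1]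

instance : IsProbabilityMeasure unifOne :=
  cond_isProbabilityMeasure_of_finite (by simp) (by simp)

theorem unifLaw_eq_pi (m : ℕ) : unifLaw m = Measure.pi fun _ => unifOne := rfl

instance (m : ℕ) : IsProbabilityMeasure (unifLaw m) := by
  rw [unifLaw_eq_pi]; infer_instance

theorem unifOne_apply_of_subset {s : Set ℝ} (hs : s ⊆ Set.Icc (-1) 1) :
    unifOne s = 2⁻¹ * volume s := by
  rw [unifOne, cond_apply measurableSet_Icc, Set.inter_eq_right.2 hs, Real.volume_Icc]
  norm_num

/-! ### Expected growth of the reachable set in one step -/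

/-- The window `[-1/2, 1/2]` of target weights. -/
def targetWindow : Set ℝ := Set.Icc (-(1 / 2)) (1 / 2)

theorem measurableSet_targetWindow : MeasurableSet targetWindow := measurableSet_Icc

theorem volume_targetWindow : volume targetWindow = 1 := by
  rw [targetWindow, Real.volume_Icc]; norm_num

/-- The part of the target window that becomes reachable from `A` by adding `x`. -/
def newlyReached (A : Set ℝ) (x : ℝ) : Set ℝ := {z | z ∈ targetWindow ∧ z ∉ A ∧ z - x ∈ A}

theorem volume_newlyReached_le (A : Set ℝ) (x : ℝ) : volume (newlyReached A x) ≤ volume A := by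
  calc volume (newlyReached A x) ≤ volume ((fun z => z - x) ⁻¹' A) :=
        measure_mono fun z hz => hz.2.2
    _ = volume A := by
        simpa only [sub_eq_add_neg] using measure_preimage_add_right volume (-x) A

theorem measurableSet_newlyReached_prod {α : Type*} [MeasurableSpace α] {A : α → Set ℝ}
    (hA : MeasurableSet {p : α × ℝ | p.2 ∈ A p.1}) :
    MeasurableSet {p : (ℝ × α) × ℝ | p.2 ∈ newlyReached (A p.1.2) p.1.1} := by
  have h1 : MeasurableSet {p : (ℝ × α) × ℝ | p.2 ∈ targetWindow} :=
    measurable_snd measurableSet_targetWindow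
  have h2 : MeasurableSet {p : (ℝ × α) × ℝ | p.2 ∈ A p.1.2} :=
    (show Measurable fun p : (ℝ × α) × ℝ => (p.1.2, p.2) by fun_prop) hA
  have h3 : MeasurableSet {p : (ℝ × α) × ℝ | p.2 - p.1.1 ∈ A p.1.2} :=
    (show Measurable fun p : (ℝ × α) × ℝ => (p.1.2, p.2 - p.1.1) by fun_prop) hA
  exact h1.inter (h2.compl.inter h3)

theorem measurableSet_newlyReached {A : Set ℝ} (hA : MeasurableSet A) :
    MeasurableSet {p : ℝ × ℝ | p.2 ∈ newlyReached A p.1} := by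
  have h := measurableSet_newlyReached_prod (α := Unit) (A := fun _ => A) (measurable_snd hA)
  exact (show Measurable fun p : ℝ × ℝ => ((p.1, ()), p.2) by fun_prop) h

/-- Differences of two points of the window lie in `[-1, 1]`, where the law has constant density
`1/2`; this is why the window has length one. -/
theorem unifOne_reflect {A : Set ℝ} (hA : MeasurableSet A) (hAI : A ⊆ targetWindow) {z : ℝ} (hz : z ∈ targetWindow) :
    unifOne {x | z - x ∈ A} = 2⁻¹ * volume A := by
  rw [unifOne_apply_of_subset]
  · congr 1
    exact (Measure.measurePreserving_sub_left volume z).measure_preimage hA.nullMeasurableSet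
  · intro x hx
    have := hAI hx
    simp only [targetWindow, Set.mem_Icc] at *
    constructor <;> linarith

/-- By Tonelli, integrate over `z` last: each `z` outside `A` is hit with the same probability, `|A|
/ 2`. -/
theorem lintegral_volume_newlyReached {A : Set ℝ} (hA : MeasurableSet A)
    (hAI : A ⊆ targetWindow) :
    ∫⁻ x, volume (newlyReached A x) ∂unifOne
      = 2⁻¹ * volume A * volume (targetWindow \ A) := by
  have hm := measurableSet_newlyReached hA
  have h1 := Measure.prod_apply (μ := unifOne) (ν := (volume : Measure ℝ)) hm
  have h2 := Measure.prod_apply_symm (μ := unifOne) (ν := (volume : Measure ℝ)) hm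
  rw [h1] at h2
  change ∫⁻ x, volume (newlyReached A x) ∂unifOne = _ at h2
  rw [h2, ← setLIntegral_const, ← lintegral_indicator (measurableSet_targetWindow.diff hA)]
  congr 1 with z
  by_cases hz : z ∈ targetWindow \ A
  · rw [Set.indicator_of_mem hz, ← unifOne_reflect hA hAI hz.1]
    congr 1 with x
    exact ⟨fun h => h.2.2, fun h => ⟨hz.1, hz.2, h⟩⟩
  · rw [Set.indicator_of_notMem hz]
    convert measure_empty (μ := unifOne)
    ext x
    simp only [Set.mem_preimage, Set.mem_ofPred_eq, Set.mem_empty_iff_false, iff_false]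
    exact fun h => hz ⟨h.1, h.2.1⟩

/-- The points of the target window reachable from `A` by adding `x` or not. -/
def extend (A : Set ℝ) (x : ℝ) : Set ℝ := A ∪ newlyReached A x

theorem extend_subset {A : Set ℝ} (hAI : A ⊆ targetWindow) (x : ℝ) :
    extend A x ⊆ targetWindow :=
  Set.union_subset hAI fun _ hz => hz.1

theorem volume_ne_top_of_subset {A : Set ℝ} (hAI : A ⊆ targetWindow) : volume A ≠ ⊤ :=
  measure_ne_top_of_subset hAI (by simp [volume_targetWindow])

theorem volume_real_le_one {A : Set ℝ} (hAI : A ⊆ targetWindow) : volume.real A ≤ 1 := by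
  have h := measureReal_mono (μ := volume) hAI (by simp [volume_targetWindow])
  simpa [Measure.real, volume_targetWindow] using h

theorem measurableSet_newlyReached_section {A : Set ℝ} (hA : MeasurableSet A) (x : ℝ) :
    MeasurableSet (newlyReached A x) :=
  measurable_prodMk_left (measurableSet_newlyReached hA)

theorem volume_real_extend {A : Set ℝ} (hA : MeasurableSet A) (hAI : A ⊆ targetWindow) (x : ℝ) :
    volume.real (extend A x) = volume.real A + volume.real (newlyReached A x) :=
  measureReal_union (Set.disjoint_left.2 fun _ h h' => h'.2.1 h)
    (measurableSet_newlyReached_section hA x) (volume_ne_top_of_subset hAI)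
    (volume_ne_top_of_subset fun _ h => h.1)

theorem volume_real_newlyReached_le {A : Set ℝ} (hAI : A ⊆ targetWindow) (x : ℝ) :
    volume.real (newlyReached A x) ≤ volume.real A :=
  ENNReal.toReal_mono (volume_ne_top_of_subset hAI) (volume_newlyReached_le A x)

theorem measurable_volume_real_newlyReached {A : Set ℝ} (hA : MeasurableSet A) :
    Measurable fun x => volume.real (newlyReached A x) :=
  (measurable_measure_prodMk_left (measurableSet_newlyReached hA)).ennreal_toReal

theorem integrable_of_measurable_of_mem_Icc {α : Type*} [MeasurableSpace α] {μ : Measure α}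
    [IsFiniteMeasure μ] {f : α → ℝ} {a b : ℝ} (hf : Measurable f)
    (h : ∀ x, f x ∈ Set.Icc a b) : Integrable f μ :=
  Integrable.of_mem_Icc a b hf.aemeasurable (Filter.Eventually.of_forall h)

theorem integrable_volume_real_newlyReached {A : Set ℝ} (hA : MeasurableSet A) :
    Integrable (fun x => volume.real (newlyReached A x)) unifOne :=
  integrable_of_measurable_of_mem_Icc (a := 0) (b := 1) (measurable_volume_real_newlyReached hA)
    fun _ => ⟨measureReal_nonneg, volume_real_le_one fun _ h => h.1⟩

theorem integral_volume_real_newlyReached {A : Set ℝ} (hA : MeasurableSet A)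
    (hAI : A ⊆ targetWindow) :
    ∫ x, volume.real (newlyReached A x) ∂unifOne
      = volume.real A * (1 - volume.real A) / 2 := by
  have h := congrArg ENNReal.toReal (lintegral_volume_newlyReached hA hAI)
  have h2 : volume.real (targetWindow \ A) = 1 - volume.real A := by
    rw [measureReal_sdiff hAI hA (volume_ne_top_of_subset subset_rfl)]
    simp [Measure.real, volume_targetWindow]
  rw [ENNReal.toReal_mul, ENNReal.toReal_mul] at h
  change _ = _ * volume.real A * volume.real (targetWindow \ A) at h
  rw [h2] at h
  have h3 := integral_toReal (μ := unifOne) (f := fun x => volume (newlyReached A x))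
    (measurable_measure_prodMk_left (measurableSet_newlyReached hA)).aemeasurable
    (Filter.Eventually.of_forall fun x =>
      (volume_ne_top_of_subset (A := newlyReached A x) fun _ h => h.1).lt_top)
  refine (h3.trans h).trans ?_
  simp only [Measure.real, ENNReal.toReal_inv, ENNReal.toReal_ofNat]
  ring

/-! ### Contraction of the odds -/

/-- The odds `(1 - |A|) / |A|` that a uniform point of the target window is not in `A`. -/
noncomputable def missOdds (A : Set ℝ) : ℝ := (volume.real A)⁻¹ - 1

/-- Convexity: on `0 ≤ t ≤ a`, the function `1 / (a + t)` lies below its chord, which has slope `-1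
/ (2 * a ^ 2)`. The bound is linear in the gain, so only its mean matters. -/
theorem missOdds_extend_le {A : Set ℝ} (hA : MeasurableSet A) (hAI : A ⊆ targetWindow)
    (hpos : 0 < volume.real A) (x : ℝ) :
    missOdds (extend A x)
      ≤ missOdds A - volume.real (newlyReached A x) / (2 * volume.real A ^ 2) := by
  rw [missOdds, missOdds, volume_real_extend hA hAI]
  have h1 := volume_real_newlyReached_le hAI x
  have h0 : 0 ≤ volume.real (newlyReached A x) := measureReal_nonneg
  generalize volume.real A = a at *
  generalize volume.real (newlyReached A x) = t at *
  have : a⁻¹ - 1 - t / (2 * a ^ 2) - ((a + t)⁻¹ - 1) = t * (a - t) / (2 * a ^ 2 * (a + t)) := by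
    field_simp
    ring
  have : 0 ≤ t * (a - t) / (2 * a ^ 2 * (a + t)) :=
    div_nonneg (mul_nonneg h0 (by linarith)) (by positivity)
  linarith

theorem missOdds_mem_Icc {A : Set ℝ} (hAI : A ⊆ targetWindow) {a : ℝ} (ha : 0 < a)
    (h : a ≤ volume.real A) : missOdds A ∈ Set.Icc 0 a⁻¹ := by
  have h1 := volume_real_le_one hAI
  have h2 : 1 ≤ (volume.real A)⁻¹ := (one_le_inv₀ (ha.trans_le h)).2 h1
  have h3 : (volume.real A)⁻¹ ≤ a⁻¹ := inv_anti₀ ha h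
  constructor <;> simp only [missOdds] <;> linarith

theorem measurable_missOdds_extend {A : Set ℝ} (hA : MeasurableSet A) (hAI : A ⊆ targetWindow) :
    Measurable fun x => missOdds (extend A x) := by
  simp only [missOdds, volume_real_extend hA hAI]
  exact ((measurable_const.add (measurable_volume_real_newlyReached hA)).inv).sub_const 1

theorem volume_real_le_extend {A : Set ℝ} (hAI : A ⊆ targetWindow) (x : ℝ) :
    volume.real A ≤ volume.real (extend A x) :=
  measureReal_mono Set.subset_union_left (volume_ne_top_of_subset (extend_subset hAI x))

theorem integral_missOdds_extend_le {A : Set ℝ} (hA : MeasurableSet A) (hAI : A ⊆ targetWindow)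
    (hpos : 0 < volume.real A) :
    ∫ x, missOdds (extend A x) ∂unifOne ≤ 3 / 4 * missOdds A := by
  have hi := integrable_volume_real_newlyReached hA
  calc ∫ x, missOdds (extend A x) ∂unifOne
      ≤ ∫ x, (missOdds A - volume.real (newlyReached A x) / (2 * volume.real A ^ 2)) ∂unifOne := by
        refine integral_mono ?_ ((integrable_const _).sub (hi.div_const _))
          (missOdds_extend_le hA hAI hpos)
        exact integrable_of_measurable_of_mem_Icc (measurable_missOdds_extend hA hAI) fun x =>
          missOdds_mem_Icc (extend_subset hAI x) hpos (volume_real_le_extend hAI x)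
    _ = 3 / 4 * missOdds A := by
        rw [integral_sub (integrable_const _) (hi.div_const _), integral_div,
          integral_volume_real_newlyReached hA hAI, missOdds]
        simp only [integral_const, probReal_univ, one_smul]
        field_simp
        ring

/-! ### Iteration over the entries -/

/-- The points of the target window reachable from `(-r, r)` by adding a subset of the entries
of `v`, one after the other, without leaving the window. -/
def reachable (r : ℝ) : (n : ℕ) → (Fin n → ℝ) → Set ℝ
  | 0, _ => Set.Ioo (-r) r
  | n + 1, v => extend (reachable r n (Fin.tail v)) (v 0)

theorem reachable_subset {r : ℝ} (hr : r ≤ 1 / 2) :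
    ∀ (n : ℕ) (v : Fin n → ℝ), reachable r n v ⊆ targetWindow
  | 0, _ => fun z hz => ⟨by linarith [hz.1], by linarith [hz.2]⟩
  | n + 1, v => extend_subset (reachable_subset hr n _) _

theorem measurableSet_reachable_prod (r : ℝ) :
    ∀ n : ℕ, MeasurableSet {p : (Fin n → ℝ) × ℝ | p.2 ∈ reachable r n p.1}
  | 0 => measurable_snd measurableSet_Ioo
  | n + 1 => by
    have ih := measurableSet_reachable_prod r n
    have ht : Measurable fun p : (Fin (n + 1) → ℝ) × ℝ => (Fin.tail p.1, p.2) := by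
      unfold Fin.tail
      fun_prop
    have ht' : Measurable fun p : (Fin (n + 1) → ℝ) × ℝ => ((p.1 0, Fin.tail p.1), p.2) := by
      unfold Fin.tail
      fun_prop
    exact (ht ih).union (ht' (measurableSet_newlyReached_prod ih))

theorem measurableSet_reachable (r : ℝ) (n : ℕ) (v : Fin n → ℝ) :
    MeasurableSet (reachable r n v) :=
  measurable_prodMk_left (measurableSet_reachable_prod r n)

theorem le_volume_real_reachable {r : ℝ} (hr : r ≤ 1 / 2) :
    ∀ (n : ℕ) (v : Fin n → ℝ), 2 * r ≤ volume.real (reachable r n v)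
  | 0, v => by
    rw [reachable, Real.volume_real_Ioo]
    exact (by linarith : 2 * r ≤ r - -r).trans (le_max_left _ _)
  | n + 1, v => (le_volume_real_reachable hr n _).trans
      (volume_real_le_extend (reachable_subset hr n _) _)

theorem measurable_missOdds_reachable (r : ℝ) (n : ℕ) :
    Measurable fun v => missOdds (reachable r n v) :=
  (((measurable_measure_prodMk_left
    (measurableSet_reachable_prod r n)).ennreal_toReal).inv).sub_const 1

theorem missOdds_reachable_mem_Icc {r : ℝ} (hr0 : 0 < r) (hr : r ≤ 1 / 2) (n : ℕ)
    (v : Fin n → ℝ) : missOdds (reachable r n v) ∈ Set.Icc 0 (2 * r)⁻¹ :=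
  missOdds_mem_Icc (reachable_subset hr n v) (by linarith) (le_volume_real_reachable hr n v)

theorem integrable_missOdds_reachable {r : ℝ} (hr0 : 0 < r) (hr : r ≤ 1 / 2) (n : ℕ) :
    Integrable (fun v => missOdds (reachable r n v)) (unifLaw n) :=
  integrable_of_measurable_of_mem_Icc (measurable_missOdds_reachable r n)
    (missOdds_reachable_mem_Icc hr0 hr n)

theorem integral_missOdds_reachable_le {r : ℝ} (hr0 : 0 < r) (hr : r ≤ 1 / 2) :
    ∀ n : ℕ, ∫ v, missOdds (reachable r n v) ∂unifLaw n ≤ (3 / 4) ^ n * (2 * r)⁻¹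
  | 0 => by
    calc ∫ v, missOdds (reachable r 0 v) ∂unifLaw 0 ≤ ∫ _, (2 * r)⁻¹ ∂unifLaw 0 :=
          integral_mono (integrable_missOdds_reachable hr0 hr 0) (integrable_const _)
            fun v => (missOdds_reachable_mem_Icc hr0 hr 0 v).2
      _ = _ := by simp
  | n + 1 => by
    have ih := integral_missOdds_reachable_le hr0 hr n
    have hmp := measurePreserving_piFinSuccAbove (fun _ : Fin (n + 1) => unifOne) 0
    let f : ℝ × (Fin n → ℝ) → ℝ := fun p => missOdds (extend (reachable r n p.2) p.1)
    have hf : (fun v : Fin (n + 1) → ℝ => missOdds (reachable r (n + 1) v))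
        = f ∘ MeasurableEquiv.piFinSuccAbove (fun _ => ℝ) 0 := rfl
    have hfi : Integrable f (unifOne.prod (unifLaw n)) := by
      refine (hmp.integrable_comp_emb (MeasurableEquiv.measurableEmbedding _)).1 ?_
      rw [← hf]
      exact integrable_missOdds_reachable hr0 hr (n + 1)
    have h1 : ∫ v, missOdds (reachable r (n + 1) v) ∂unifLaw (n + 1)
        = ∫ p, f p ∂unifOne.prod (unifLaw n) := by
      rw [hf]
      exact hmp.integral_comp' f
    rw [h1, integral_prod_symm _ hfi]
    calc ∫ v, ∫ x, f (x, v) ∂unifOne ∂unifLaw n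
        ≤ ∫ v, 3 / 4 * missOdds (reachable r n v) ∂unifLaw n := by
          refine integral_mono hfi.integral_prod_right
            ((integrable_missOdds_reachable hr0 hr n).const_mul _) fun v => ?_
          exact integral_missOdds_extend_le (measurableSet_reachable r n v)
            (reachable_subset hr n v)
            (lt_of_lt_of_le (by linarith) (le_volume_real_reachable hr n v))
      _ ≤ (3 / 4) ^ (n + 1) * (2 * r)⁻¹ := by
          rw [integral_const_mul, pow_succ]
          linarith

theorem exists_mask_of_mem_reachable {r : ℝ} :
    ∀ {n : ℕ} {v : Fin n → ℝ} {z : ℝ}, z ∈ reachable r n v →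
      ∃ s : Fin n → ℝ, IsMask s ∧ |z - ∑ i, s i * v i| < r
  | 0, _, z, hz => ⟨0, fun i => i.elim0, by simpa [abs_lt, reachable] using hz⟩
  | n + 1, v, z, Or.inl hz => by
    obtain ⟨s, hs, h⟩ := exists_mask_of_mem_reachable hz
    refine ⟨Fin.cons 0 s, Fin.cases (by simp) (fun i => by simpa using hs i), ?_⟩
    simpa [Fin.sum_univ_succ, Fin.tail] using h
  | n + 1, v, z, Or.inr hz => by
    obtain ⟨s, hs, h⟩ := exists_mask_of_mem_reachable hz.2.2
    refine ⟨Fin.cons 1 s, Fin.cases (by simp) (fun i => by simpa using hs i), ?_⟩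
    simpa [Fin.sum_univ_succ, Fin.tail, sub_sub] using h

/-! ### From nearly full measure to covering every weight -/

/-- Otherwise `R` would avoid an interval of length `r` with endpoint `w`; taken on the side of `w`
towards `0`, it stays in the window, whose total length is only one. -/
theorem exists_mem_abs_sub_lt_of_volume {R : Set ℝ} (hR : MeasurableSet R)
    (hRI : R ⊆ targetWindow) {r : ℝ} (hr : r ≤ 1 / 2) (hvol : 1 - r < volume.real R) {w : ℝ}
    (hw : w ∈ targetWindow) : ∃ z ∈ R, |w - z| < r := by
  by_contra! hcon
  obtain ⟨a, haI, har⟩ : ∃ a : ℝ, Set.Ioo a (a + r) ⊆ targetWindow ∧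
      ∀ z ∈ Set.Ioo a (a + r), |w - z| < r := by
    rcases le_total w 0 with h | h
    · refine ⟨w, fun z hz => ⟨hw.1.trans hz.1.le, by linarith [hz.2]⟩, fun z hz => ?_⟩
      rw [abs_lt]
      constructor <;> linarith [hz.1, hz.2]
    · refine ⟨w - r, fun z hz => ⟨by linarith [hz.1], by linarith [hz.2, hw.2]⟩, fun z hz => ?_⟩
      rw [abs_lt]
      constructor <;> linarith [hz.1, hz.2]
  have hdisj : Disjoint (Set.Ioo a (a + r)) R :=
    Set.disjoint_left.2 fun z hz hzR => absurd (har z hz) (not_lt.2 (hcon z hzR))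
  have h1 := measureReal_union hdisj hR (volume_ne_top_of_subset haI)
    (volume_ne_top_of_subset hRI)
  have h2 := volume_real_le_one (Set.union_subset haI hRI)
  have h3 : r ≤ volume.real (Set.Ioo a (a + r)) := by
    rw [Real.volume_real_Ioo]
    exact (by linarith : r ≤ a + r - a).trans (le_max_left _ _)
  linarith

/-- Every target weight is within `η` of a perturbed subset sum of the entries of `v`. -/
def Covers {n : ℕ} (ε η : ℝ) (v : Fin n → ℝ) : Prop :=
  ∀ w ∈ targetWindow, ∃ s y : Fin n → ℝ, IsMask s ∧ IsPerturbation ε y ∧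
    |w - ∑ i, s i * (v i + y i)| < η

theorem covers_of_missOdds_lt {n : ℕ} {ε η : ℝ} (hε : 0 ≤ ε) (hη0 : 0 < η) (hη : η ≤ 1)
    {v : Fin n → ℝ} (h : missOdds (reachable (η / 2) n v) < η / 2) : Covers ε η v := by
  intro w hw
  have hr : η / 2 ≤ 1 / 2 := by linarith
  have hsub := reachable_subset hr n v
  have hpos : 0 < volume.real (reachable (η / 2) n v) :=
    lt_of_lt_of_le (by linarith) (le_volume_real_reachable hr n v)
  have hvol : 1 - η / 2 < volume.real (reachable (η / 2) n v) := by
    have h1 := volume_real_le_one hsub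
    rw [missOdds] at h
    have h2 : 1 < (1 + η / 2) * volume.real (reachable (η / 2) n v) := by
      rw [← div_lt_iff₀ hpos, one_div]
      linarith
    nlinarith
  obtain ⟨z, hz, hwz⟩ :=
    exists_mem_abs_sub_lt_of_volume (measurableSet_reachable _ n v) hsub hr hvol hw
  obtain ⟨s, hs, hsz⟩ := exists_mask_of_mem_reachable hz
  refine ⟨s, 0, hs, fun i => ⟨by simpa using hε, by simpa using hε⟩, ?_⟩
  simp only [Pi.zero_apply, add_zero]
  have := abs_sub_le w z (∑ i, s i * v i)
  linarith

theorem unifLaw_not_covers_le {n : ℕ} {ε η : ℝ} (hε : 0 ≤ ε) (hη0 : 0 < η) (hη : η ≤ 1) :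
    (unifLaw n).real {v | ¬ Covers ε η v} ≤ 2 * (3 / 4) ^ n / η ^ 2 := by
  have hr0 : 0 < η / 2 := by linarith
  have hr : η / 2 ≤ 1 / 2 := by linarith
  have hmk := mul_meas_ge_le_integral_of_nonneg
    (Filter.Eventually.of_forall fun v => (missOdds_reachable_mem_Icc hr0 hr n v).1)
    (integrable_missOdds_reachable hr0 hr n) (η / 2)
  have hint := integral_missOdds_reachable_le hr0 hr n
  have hmono : (unifLaw n).real {v | ¬ Covers ε η v}
      ≤ (unifLaw n).real {v | η / 2 ≤ missOdds (reachable (η / 2) n v)} :=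
    measureReal_mono fun v hv => not_lt.1 fun h => hv (covers_of_missOdds_lt hε hη0 hη h)
  rw [mul_div_cancel₀ η two_ne_zero] at hint
  rw [le_div_iff₀ (by positivity)]
  have h1 := mul_le_mul_of_nonneg_left (hmk.trans hint) (by positivity : (0 : ℝ) ≤ 2 * η)
  have h2 : 2 * η * ((3 / 4) ^ n * η⁻¹) = 2 * (3 / 4) ^ n := by field_simp
  nlinarith [mul_le_mul_of_nonneg_left hmono (sq_nonneg η)]

theorem covers_of_half_lt {n : ℕ} {ε η : ℝ} (hε : 0 ≤ ε) (hη : 1 / 2 < η) (v : Fin n → ℝ) :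
    Covers ε η v := by
  intro w hw
  refine ⟨0, 0, fun i => Or.inl rfl, fun i => ⟨by simpa using hε, by simpa using hε⟩, ?_⟩
  simp only [Pi.zero_apply, zero_mul, Finset.sum_const_zero, sub_zero]
  exact lt_of_le_of_lt (abs_le.2 hw) hη

theorem covers_of_three_halves_le {n : ℕ} {ε η : ℝ} (hε : 3 / 2 ≤ ε) (hη : 0 < η)
    {v : Fin n → ℝ} (i : Fin n) (hv : v i ∈ Set.Icc (-1) 1) : Covers ε η v := by
  intro w hw
  -- One neuron suffices, as `|w - v i| ≤ 1/2 + 1 ≤ ε`.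
  refine ⟨Pi.single i 1, Pi.single i (w - v i), fun j => ?_, fun j => ?_, ?_⟩
  · by_cases h : j = i
    · subst h; simp
    · simp [h]
  · by_cases h : j = i
    · subst h
      rw [Pi.single_eq_same]
      constructor <;> linarith [hw.1, hw.2, hv.1, hv.2]
    · rw [Pi.single_eq_of_ne h]
      constructor <;> linarith
  · simpa [Pi.single_apply, ite_mul] using hη

theorem unifLaw_not_covers_eq_zero {n : ℕ} {ε η : ℝ} (hε : 3 / 2 ≤ ε) (hη : 0 < η)
    (hn : 0 < n) : (unifLaw n).real {v | ¬ Covers ε η v} = 0 := by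
  let i : Fin n := ⟨0, hn⟩
  have hmp : MeasurePreserving (Function.eval i) (unifLaw n) unifOne :=
    measurePreserving_eval (fun _ => unifOne) i
  have h0 : unifOne (Set.Icc (-1) 1)ᶜ = 0 := by
    rw [unifOne, cond_apply measurableSet_Icc]
    simp
  have h1 : unifLaw n (Function.eval i ⁻¹' (Set.Icc (-1) 1)ᶜ) = 0 := by
    rw [hmp.measure_preimage measurableSet_Icc.compl.nullMeasurableSet, h0]
  rw [measureReal_eq_zero_iff]
  exact measure_mono_null (fun v hv h => hv (covers_of_three_halves_le hε hη i h)) h1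

/-! ### Splitting the network into two subset sums -/

theorem measurePreserving_unifLaw_comp {m n : ℕ} {g : Fin n → Fin m}
    (hg : Function.Injective g) :
    MeasurePreserving (fun v : Fin m → ℝ => v ∘ g) (unifLaw m) (unifLaw n) := by
  have hind : iIndepFun (fun (i : Fin m) (v : Fin m → ℝ) => v i) (unifLaw m) :=
    iIndepFun_pi (μ := fun _ : Fin m => unifOne) (X := fun _ x => x) fun _ => aemeasurable_id
  have hmap := (iIndepFun_iff_map_fun_eq_pi_map
    (fun i => (measurable_pi_apply (g i)).aemeasurable)).1 (hind.precomp hg)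
  refine ⟨measurable_pi_lambda _ fun i => measurable_pi_apply (g i), hmap.trans ?_⟩
  rw [unifLaw_eq_pi n]
  congr 1 with i : 1
  exact (measurePreserving_eval (fun _ : Fin m => unifOne) (g i)).map_eq

/-- The position in `Fin (2 * n)` of the `i`-th neuron with positive first-layer weight. -/
def posIndex {n : ℕ} (i : Fin n) : Fin (2 * n) := Fin.cast (two_mul n).symm (Fin.castAdd n i)

/-- The position in `Fin (2 * n)` of the `i`-th neuron with negative first-layer weight. -/
def negIndex {n : ℕ} (i : Fin n) : Fin (2 * n) := Fin.cast (two_mul n).symm (Fin.natAdd n i)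

theorem posIndex_injective {n : ℕ} : Function.Injective (posIndex (n := n)) :=
  (Fin.cast_injective _).comp (Fin.castAdd_injective n n)

theorem negIndex_injective {n : ℕ} : Function.Injective (negIndex (n := n)) :=
  (Fin.cast_injective _).comp (Fin.natAdd_injective n n)

theorem sum_two_mul {n : ℕ} (f : Fin (2 * n) → ℝ) :
    ∑ i, f i = ∑ i, f (posIndex i) + ∑ i, f (negIndex i) := by
  rw [← Fin.sum_congr' f (two_mul n).symm, Fin.sum_univ_add]
  rfl

/-- The vector on all `2 * n` neurons with prescribed positive and negative halves. -/
def joinHalves {n : ℕ} (a b : Fin n → ℝ) : Fin (2 * n) → ℝ :=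
  Fin.append a b ∘ Fin.cast (two_mul n)

theorem joinHalves_posIndex {n : ℕ} (a b : Fin n → ℝ) (i : Fin n) :
    joinHalves a b (posIndex i) = a i := by
  simp [joinHalves, posIndex]

theorem joinHalves_negIndex {n : ℕ} (a b : Fin n → ℝ) (i : Fin n) :
    joinHalves a b (negIndex i) = b i := by
  simp [joinHalves, negIndex, -Fin.natAdd_eq_addNat]

theorem forall_joinHalves {n : ℕ} {a b : Fin n → ℝ} {p : ℝ → Prop} (ha : ∀ i, p (a i))
    (hb : ∀ i, p (b i)) (i : Fin (2 * n)) : p (joinHalves a b i) := by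
  simp only [joinHalves, Function.comp_apply]
  refine Fin.addCases (fun j => ?_) (fun j => ?_) (Fin.cast (two_mul n) i)
  · simpa using ha j
  · simpa [-Fin.natAdd_eq_addNat] using hb j

theorem signLayer_posIndex {n : ℕ} (i : Fin n) : signLayer n (posIndex i) = 1 := by
  simp [signLayer, posIndex]

theorem signLayer_negIndex {n : ℕ} (i : Fin n) : signLayer n (negIndex i) = -1 := by
  simp [signLayer, negIndex]

theorem relu_mask_mul {s : ℝ} (hs : s = 0 ∨ s = 1) (x : ℝ) : relu (s * x) = s * relu x := by
  rcases hs with rfl | rfl <;> simp [relu]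

theorem twoLayerNet_joinHalves {n : ℕ} (v : Fin (2 * n) → ℝ) {s₁ s₂ y₁ y₂ : Fin n → ℝ}
    (hs₁ : IsMask s₁) (hs₂ : IsMask s₂) (x : ℝ) :
    twoLayerNet (v + joinHalves y₁ y₂) (signLayer n * joinHalves s₁ s₂) x
      = (∑ i, s₁ i * (v (posIndex i) + y₁ i)) * relu x
        + (∑ i, s₂ i * (v (negIndex i) + y₂ i)) * relu (-x) := by
  rw [twoLayerNet, sum_two_mul, Finset.sum_mul, Finset.sum_mul]
  congr 1
  · refine Finset.sum_congr rfl fun i _ => ?_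
    simp only [Pi.add_apply, Pi.mul_apply, joinHalves_posIndex, signLayer_posIndex, one_mul,
      relu_mask_mul (hs₁ i)]
    ring
  · refine Finset.sum_congr rfl fun i _ => ?_
    simp only [Pi.add_apply, Pi.mul_apply, joinHalves_negIndex, signLayer_negIndex]
    rw [show -1 * s₂ i * x = s₂ i * -x by ring, relu_mask_mul (hs₂ i)]
    ring

/-- For either sign of `x` only one of the two ReLU terms survives, so the errors do not add up. -/
theorem abs_sub_relu_combination_le {w a b x : ℝ} (hx : x ∈ Set.Icc (-1 : ℝ) 1) :
    |w * x - (a * relu x + b * relu (-x))| ≤ max |w - a| |-w - b| := by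
  rcases le_total 0 x with h | h
  · refine le_max_of_le_left ?_
    rw [relu, relu, max_eq_right h, max_eq_left (by linarith),
      show w * x - (a * x + b * 0) = (w - a) * x by ring, abs_mul, abs_of_nonneg h]
    exact mul_le_of_le_one_right (abs_nonneg _) hx.2
  · refine le_max_of_le_right ?_
    rw [relu, relu, max_eq_left h, max_eq_right (by linarith),
      show w * x - (a * 0 + b * -x) = (-w - b) * -x by ring, abs_mul,
      abs_of_nonneg (by linarith : 0 ≤ -x)]
    exact mul_le_of_le_one_right (abs_nonneg _) (by linarith [hx.1])

theorem exists_approxError_lt {n : ℕ} {ε η : ℝ} {v : Fin (2 * n) → ℝ}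
    (h₁ : Covers ε η (v ∘ posIndex)) (h₂ : Covers ε η (v ∘ negIndex)) {w : ℝ}
    (hw : w ∈ Set.Icc (-(1 / 2) : ℝ) (1 / 2)) :
    ∃ s y : Fin (2 * n) → ℝ, IsMask s ∧ IsPerturbation ε y ∧
      approxError w v y (signLayer n) s < η := by
  obtain ⟨s₁, y₁, hs₁, hy₁, e₁⟩ := h₁ w hw
  obtain ⟨s₂, y₂, hs₂, hy₂, e₂⟩ := h₂ (-w) ⟨by linarith [hw.2], by linarith [hw.1]⟩
  refine ⟨joinHalves s₁ s₂, joinHalves y₁ y₂,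
    forall_joinHalves (p := fun t => t = 0 ∨ t = 1) hs₁ hs₂,
    forall_joinHalves (p := fun t => t ∈ Set.Icc (-ε) ε) hy₁ hy₂, ?_⟩
  have : Nonempty (Set.Icc (-1 : ℝ) 1) := ⟨⟨0, by norm_num, by norm_num⟩⟩
  refine lt_of_le_of_lt (ciSup_le fun x => ?_) (max_lt e₁ e₂)
  rw [twoLayerNet_joinHalves v hs₁ hs₂]
  exact abs_sub_relu_combination_le x.2

theorem one_sub_le_unifLaw_approx {n : ℕ} {ε η q : ℝ}
    (hq : (unifLaw n).real {v | ¬ Covers ε η v} ≤ q) :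
    1 - 2 * q ≤ (unifLaw (2 * n)).real
      {v | ∀ w ∈ Set.Icc (-(1 / 2) : ℝ) (1 / 2),
        ∃ s y : Fin (2 * n) → ℝ, IsMask s ∧ IsPerturbation ε y ∧
          approxError w v y (signLayer n) s < η} := by
  set S := {v : Fin (2 * n) → ℝ | ∀ w ∈ Set.Icc (-(1 / 2) : ℝ) (1 / 2),
        ∃ s y : Fin (2 * n) → ℝ, IsMask s ∧ IsPerturbation ε y ∧
          approxError w v y (signLayer n) s < η}
  have hhalf : ∀ g : Fin n → Fin (2 * n), Function.Injective g →
      (unifLaw (2 * n)).real {v | ¬ Covers ε η (v ∘ g)} ≤ q := fun g hg => by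
    have hmp := measurePreserving_unifLaw_comp hg
    -- This inequality holds for arbitrary sets, so measurability of `Covers` is not required.
    have h := Measure.le_map_apply (μ := unifLaw (2 * n)) hmp.measurable.aemeasurable {v | ¬ Covers ε η v}
    rw [hmp.map_eq] at h
    exact (ENNReal.toReal_mono (measure_ne_top _ _) h).trans hq
  have hcover : Set.univ ⊆ S ∪ ({v | ¬ Covers ε η (v ∘ posIndex)} ∪
      {v | ¬ Covers ε η (v ∘ negIndex)}) := by
    intro v _
    by_contra hv
    simp only [Set.mem_union, Set.mem_ofPred_eq, not_or, not_not] at hv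
    exact hv.1 fun w hw => exists_approxError_lt hv.2.1 hv.2.2 hw
  have h1 := measureReal_mono (μ := unifLaw (2 * n)) hcover
  rw [probReal_univ] at h1
  have h2 := measureReal_union_le (μ := unifLaw (2 * n)) S
    ({v | ¬ Covers ε η (v ∘ posIndex)} ∪ {v | ¬ Covers ε η (v ∘ negIndex)})
  have h3 := measureReal_union_le (μ := unifLaw (2 * n))
    {v | ¬ Covers ε η (v ∘ posIndex)} {v | ¬ Covers ε η (v ∘ negIndex)}
  linarith [hhalf _ posIndex_injective, hhalf _ negIndex_injective]

/-! ### Numerical estimates and conclusion -/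

theorem three_quarters_pow_le_exp (n : ℕ) : (3 / 4 : ℝ) ^ n ≤ Real.exp (-((n : ℝ) / 4)) := by
  calc (3 / 4 : ℝ) ^ n ≤ Real.exp (-(1 / 4)) ^ n := by
        gcongr
        linarith [Real.add_one_le_exp (-(1 / 4) : ℝ)]
    _ = Real.exp (-((n : ℝ) / 4)) := by
        rw [← Real.exp_nat_mul]
        congr 1
        ring

/-- The prefactor costs `4 * log η⁻¹ ≤ k / 6`, and `1/6 + 1/18 ≤ 1/4`; hence the constant `24`. -/
theorem four_mul_three_quarters_pow_div_sq_le {η : ℝ} {k n : ℕ} (hkn : k ≤ n) (hη0 : 0 < η)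
    (hη : η ≤ 1 / 2) (hk : 24 * Real.log η⁻¹ ≤ k) :
    4 * (3 / 4) ^ n / η ^ 2 ≤ Real.exp (-((k : ℝ) / 18)) := by
  have h1 : 4 / η ^ 2 ≤ Real.exp (4 * Real.log η⁻¹) := by
    have : Real.exp (4 * Real.log η⁻¹) = (η⁻¹) ^ 4 := by
      rw [show (4 : ℝ) * Real.log η⁻¹ = (4 : ℕ) * Real.log η⁻¹ by norm_num, Real.exp_nat_mul,
        Real.exp_log (by positivity)]
    rw [this]
    have h2 : 2 ≤ η⁻¹ := by
      rw [le_inv_comm₀ two_pos hη0]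
      linarith
    have h4 : 4 ≤ (η⁻¹) ^ 2 := by nlinarith
    calc 4 / η ^ 2 = 4 * (η⁻¹) ^ 2 := by rw [div_eq_mul_inv, inv_pow]
      _ ≤ (η⁻¹) ^ 2 * (η⁻¹) ^ 2 := by gcongr
      _ = (η⁻¹) ^ 4 := by ring
  have h2 : (3 / 4 : ℝ) ^ n ≤ Real.exp (-((k : ℝ) / 4)) :=
    (pow_le_pow_of_le_one (by norm_num) (by norm_num) hkn).trans (three_quarters_pow_le_exp k)
  calc 4 * (3 / 4) ^ n / η ^ 2 = 4 / η ^ 2 * (3 / 4) ^ n := by ring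
    _ ≤ Real.exp (4 * Real.log η⁻¹) * Real.exp (-((k : ℝ) / 4)) := by gcongr
    _ = Real.exp (4 * Real.log η⁻¹ + -((k : ℝ) / 4)) := (Real.exp_add _ _).symm
    _ ≤ Real.exp (-((k : ℝ) / 18)) := by
        apply Real.exp_le_exp.2
        have : (0 : ℝ) ≤ k := k.cast_nonneg
        linarith

theorem exp_neg_div_le_failureBound (ε η : ℝ) (K₁ K₂ : ℕ) :
    Real.exp (-((K₁ : ℝ) / 18)) ≤ failureBound ε η K₁ K₂ := by
  unfold failureBound
  linarith [Real.exp_pos (-((K₂ : ℝ) * (1 + ε) ^ 2 / (8 * (3 - ε) ^ 2))),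
    Real.exp_pos (-(max ε η * (K₁ : ℝ)))]

theorem mainTheorem3 :
    ∃ C₁ C₂ : ℝ, 0 < C₁ ∧ 0 < C₂ ∧
      ∀ (ε η : ℝ) (K₁ K₂ : ℕ), 0 ≤ ε → ε ≠ 3 → 0 < η →
        C₁ * (Real.log η⁻¹ / Real.log (5 / 4 + ε / 2)) ≤ (K₁ : ℝ) →
        C₂ * (Real.log η⁻¹ / (1 + ε)) ≤ (K₂ : ℝ) →
        1 - failureBound ε η K₁ K₂ ≤
          (unifLaw (2 * (K₁ + K₂))).real
            {v | ∀ w ∈ Set.Icc (-(1 / 2) : ℝ) (1 / 2),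
              ∃ s y : Fin (2 * (K₁ + K₂)) → ℝ, IsMask s ∧ IsPerturbation ε y ∧
                approxError w v y (signLayer (K₁ + K₂)) s < η} := by
  refine ⟨24, 1, by norm_num, one_pos, fun ε η K₁ K₂ hε _ hη0 hK₁ _ => ?_⟩
  have hδ := exp_neg_div_le_failureBound ε η K₁ K₂
  have hexp := Real.exp_pos (-((K₁ : ℝ) / 18))
  rcases lt_or_ge (1 / 2) η with hη | hη
  · have hq : (unifLaw (K₁ + K₂)).real {v | ¬ Covers ε η v} ≤ 0 := by
      simp [covers_of_half_lt hε hη]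
    linarith [one_sub_le_unifLaw_approx hq]
  have hlogη : 0 < Real.log η⁻¹ := Real.log_pos ((one_lt_inv₀ hη0).2 (by linarith))
  have hlogε : 0 < Real.log (5 / 4 + ε / 2) := Real.log_pos (by linarith)
  rcases le_or_gt (3 / 2) ε with hε' | hε'
  · have hpos : 0 < K₁ + K₂ := by
      -- Both logarithms are positive, so the hypothesis on `K₁` guarantees that a neuron exists.
      have h : (0 : ℝ) < K₁ := lt_of_lt_of_le (by positivity) hK₁
      have h' : 0 < K₁ := by exact_mod_cast h
      omega
    linarith [one_sub_le_unifLaw_approx (unifLaw_not_covers_eq_zero hε' hη0 hpos).le]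
  · have hlog1 : Real.log (5 / 4 + ε / 2) ≤ 1 := by
      linarith [Real.log_le_sub_one_of_pos (by linarith : (0 : ℝ) < 5 / 4 + ε / 2)]
    have hK : 24 * Real.log η⁻¹ ≤ K₁ := by
      have h : Real.log η⁻¹ ≤ Real.log η⁻¹ / Real.log (5 / 4 + ε / 2) := by
        rw [le_div_iff₀ hlogε]
        exact mul_le_of_le_one_right hlogη.le hlog1
      linarith
    have hq := one_sub_le_unifLaw_approx
      (unifLaw_not_covers_le (n := K₁ + K₂) hε hη0 (by linarith))
    have hb := four_mul_three_quarters_pow_div_sq_le (Nat.le_add_right K₁ K₂) hη0 hη hK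
    have heq : 2 * (2 * (3 / 4) ^ (K₁ + K₂) / η ^ 2) = 4 * (3 / 4) ^ (K₁ + K₂) / η ^ 2 := by
      ring
    linarith
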